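/- Let $d\ge 2$ be an integer, let $\mathbb{S}^d$ be the unit sphere in $\mathbb{R}^{d+1}$ and let $\sigma_d$ be the normalized uniform surface area measure on $\mathbb{S}^d$. For points $x_1,\dots,x_N\in\mathbb{S}^d$ (not necessarily distinct) let $$D(x_1,\dots,x_N)=\sqrt{\int_{-1}^{1}\int_{\mathbb{S}^d}\left|\frac{|\{k: x_k\in C(x,t)\}|}{N}-\sigma_d(C(x,t))\right|^2 d\sigma_d(x)\,dt},\qquad C(x,t)=\{z\in\mathbb{S}^d: z\cdot x\ge t\},$$ be their spherical cap $\mathbb{L}_2$-discrepancy. Then $$\liminf_{N\to\infty}\ \inf_{x_1,\dots,x_N\in\mathbb{S}^d} N^{\frac12+\frac1{2d}}\,D(x_1,\dots,x_N)\ \ge\ c_d^{***},$$ where $$c_d^{***}=\sqrt{\frac{C_d}{\sqrt{\pi}}\,\frac{1}{1+\frac1d}\left(\frac{2\,\Gamma(\frac12)}{\Gamma(\frac{d+1}{2})}\right)^{\frac1d}},\qquad C_d=\frac1d\,\frac{\Gamma(\frac{d+1}{2})}{\sqrt{\pi}\,\Gamma(\frac d2)}.$$ In particular, $c_2^{***}=\dfrac{1}{\sqrt{3\sqrt{\pi}}}$.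 -/

import Mathlib

open MeasureTheory Filter

noncomputable section

namespace CapDiscrepancy

/-- The unit sphere `𝕊^d` in the Euclidean space `ℝ^(d+1)`. -/
abbrev Sph (d : ℕ) : Type :=
  Metric.sphere (0 : EuclideanSpace ℝ (Fin (d + 1))) 1

/-- The normalized uniform surface area measure `σ_d` on `𝕊^d`: the surface measure induced by
Lebesgue measure, divided by its total mass. -/
def sigma (d : ℕ) : Measure (Sph d) :=
  ((volume : Measure (EuclideanSpace ℝ (Fin (d + 1)))).toSphere Set.univ)⁻¹ •
    (volume : Measure (EuclideanSpace ℝ (Fin (d + 1)))).toSphere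

/-- The spherical cap `C(p, t) = {z ∈ 𝕊^d : z · p ≥ t}`. -/
def cap {d : ℕ} (p : Sph d) (t : ℝ) : Set (Sph d) :=
  {z | t ≤ inner ℝ (z : EuclideanSpace ℝ (Fin (d + 1))) (p : EuclideanSpace ℝ (Fin (d + 1)))}

/-- The spherical cap `𝕃₂`-discrepancy of the points `x_1, …, x_N ∈ 𝕊^d`. -/
def discrepancy {d N : ℕ} (x : Fin N → Sph d) : ℝ :=
  Real.sqrt (∫ t in (-1 : ℝ)..1, ∫ p : Sph d,
    |(({k : Fin N | x k ∈ cap p t}.ncard : ℝ) / (N : ℝ)) - (sigma d).real (cap p t)| ^ 2 ∂(sigma d))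

/-- The constant `C_d = (1/d) Γ((d+1)/2) / (√π Γ(d/2))`. -/
def stolarskyConst (d : ℕ) : ℝ :=
  (1 / (d : ℝ)) * (Real.Gamma (((d : ℝ) + 1) / 2) / (Real.sqrt Real.pi * Real.Gamma ((d : ℝ) / 2)))

/-- The constant `c_d^{***}`. -/
def cStar (d : ℕ) : ℝ :=
  Real.sqrt (stolarskyConst d / Real.sqrt Real.pi * (1 / (1 + 1 / (d : ℝ))) *
    (2 * Real.Gamma (1 / 2) / Real.Gamma (((d : ℝ) + 1) / 2)) ^ (1 / (d : ℝ)))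

end CapDiscrepancy

end

/-! Stolarsky's invariance principle (`discrepancy_sq`) writes the squared discrepancy as `C_d`
times the gap between the mean distance on the sphere and the average distance of the points. By
`integral_one_sub_exp_mul_rpow`, a distance is a positive mixture of the functions 1 - exp(-t r²)
with weight t^(-3/2). The gap is therefore 1/(2√π) times the integral over t > 0, with that weight,
of the Gaussian average over pairs of points minus the spherical Gaussian mean.

Two bounds control this difference at scale t. It is nonnegative because the Gaussian kernel is
positive definite with constant means (`gaussMean_le_average`). It is also at least 1/N - A
t^(-d/2), where A is `gaussConst d`: the diagonal pairs alone contribute 1/N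
(`diagonal_le_sum_exp`), and the mean is at most A t^(-d/2) (`gaussMean_le`). Using the first bound
up to the t where the second vanishes, and the second beyond it, gives the stated constant for every
N ≥ 1 and not only in the limit (`cStar_le`). -/

/-! ### Polar and axial coordinates -/

open scoped ENNReal in
theorem lintegral_eq_lintegral_toSphere {E : Type*} [NormedAddCommGroup E] [NormedSpace ℝ E]
    [MeasurableSpace E] [BorelSpace E] [FiniteDimensional ℝ E] [Nontrivial E] (μ : Measure E)
    [μ.IsAddHaarMeasure] {F : E → ℝ≥0∞} (hF : Measurable F) :
    ∫⁻ z, F z ∂μ = ∫⁻ y, (∫⁻ r in Set.Ioi (0 : ℝ),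
      ENNReal.ofReal (r ^ (Module.finrank ℝ E - 1)) * F (r • (y : E))) ∂μ.toSphere := by
  calc ∫⁻ z, F z ∂μ = ∫⁻ z in {(0 : E)}ᶜ, F z ∂μ := by rw [restrict_compl_singleton]
    _ = ∫⁻ z : ({(0 : E)}ᶜ : Set E), F z ∂(μ.comap (↑)) := by
        rw [lintegral_subtype_comap (measurableSet_singleton _).compl]
    _ = ∫⁻ p : Metric.sphere (0 : E) 1 × Set.Ioi (0 : ℝ), F (p.2.1 • (p.1 : E))
          ∂(μ.toSphere.prod (.volumeIoiPow (Module.finrank ℝ E - 1))) := by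
        rw [← μ.measurePreserving_homeomorphUnitSphereProd.lintegral_comp (by fun_prop)]
        refine lintegral_congr fun z => ?_
        have : ‖(z : E)‖ ≠ 0 := norm_ne_zero_iff.2 z.2
        simp [homeomorphUnitSphereProd, smul_smul, this]
    _ = _ := by
        rw [lintegral_prod _ (by fun_prop)]
        refine lintegral_congr fun y => ?_
        rw [Measure.volumeIoiPow, lintegral_withDensity_eq_lintegral_mul _ (by fun_prop)
          (by fun_prop), ← lintegral_subtype_comap measurableSet_Ioi]
        rfl

theorem measurePreserving_euclideanSpace_succ (d : ℕ) :
    MeasurePreserving (fun z : EuclideanSpace ℝ (Fin (d + 1)) =>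
      (z 0, (WithLp.toLp 2 (fun i : Fin d => z i.succ) : EuclideanSpace ℝ (Fin d)))) := by
  have h1 := PiLp.volume_preserving_ofLp (Fin (d + 1))
  have h2 := volume_preserving_piFinSuccAbove (fun _ : Fin (d + 1) => ℝ) 0
  have h3 := (MeasurePreserving.id (volume : Measure ℝ)).prod (PiLp.volume_preserving_toLp (Fin d))
  exact h3.comp (h2.comp h1)

theorem norm_sq_euclideanSpace_succ {d : ℕ} (z : EuclideanSpace ℝ (Fin (d + 1))) :
    ‖z‖ ^ 2 = z 0 ^ 2 +
      ‖(WithLp.toLp 2 (fun i : Fin d => z i.succ) : EuclideanSpace ℝ (Fin d))‖ ^ 2 := by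
  simp [EuclideanSpace.norm_sq_eq, Fin.sum_univ_succ]

-- Polar coordinates in the last d coordinates leave an integral over the half-plane of pairs (z 0,
-- ρ) with ρ > 0. Planar polar coordinates there contribute r, and ρ^(d-1) becomes (r sin θ)^(d-1).
open scoped ENNReal in
theorem lintegral_axial_eq {d : ℕ} (hd : 1 ≤ d) {g : ℝ → ℝ → ℝ≥0∞}
    (hg : Measurable (Function.uncurry g)) :
    ∫⁻ z : EuclideanSpace ℝ (Fin (d + 1)), g (z 0) ‖z‖ =
      (volume : Measure (EuclideanSpace ℝ (Fin d))).toSphere Set.univ *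
        ∫⁻ r in Set.Ioi (0 : ℝ), ∫⁻ θ in Set.Ioo 0 Real.pi,
          ENNReal.ofReal (r ^ d * Real.sin θ ^ (d - 1)) * g (r * Real.cos θ) r := by
  have : Nonempty (Fin d) := ⟨⟨0, hd⟩⟩
  have hg' : ∀ {α : Type} [MeasurableSpace α] {a b : α → ℝ}, Measurable a → Measurable b →
      Measurable fun x => g (a x) (b x) := fun ha hb => hg.comp (ha.prodMk hb)
  set S := (volume : Measure (EuclideanSpace ℝ (Fin d))).toSphere Set.univ
  set H : ℝ × ℝ → ℝ≥0∞ := fun p => (Set.Ioi (0 : ℝ)).indicator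
    (fun ρ => ENNReal.ofReal (ρ ^ (d - 1)) * g p.1 (Real.sqrt (p.1 ^ 2 + ρ ^ 2))) p.2 with hH
  have hHm : Measurable H := by
    have : H = (Set.univ ×ˢ Set.Ioi (0 : ℝ)).indicator (fun p : ℝ × ℝ =>
        ENNReal.ofReal (p.2 ^ (d - 1)) * g p.1 (Real.sqrt (p.1 ^ 2 + p.2 ^ 2))) := by
      ext p
      by_cases h : 0 < p.2 <;> simp [hH, Set.indicator, h]
    rw [this]
    exact (Measurable.mul (by fun_prop) (hg' (by fun_prop) (by fun_prop))).indicator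
      (MeasurableSet.univ.prod measurableSet_Ioi)
  calc ∫⁻ z : EuclideanSpace ℝ (Fin (d + 1)), g (z 0) ‖z‖
      = ∫⁻ p : ℝ × EuclideanSpace ℝ (Fin d), g p.1 (Real.sqrt (p.1 ^ 2 + ‖p.2‖ ^ 2)) := by
        rw [← (measurePreserving_euclideanSpace_succ d).lintegral_comp
          (hg' (by fun_prop) (by fun_prop))]
        refine lintegral_congr fun z => ?_
        rw [← norm_sq_euclideanSpace_succ, Real.sqrt_sq (norm_nonneg _)]
    _ = ∫⁻ s : ℝ, S * ∫⁻ ρ, H (s, ρ) := by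
        rw [Measure.volume_eq_prod, lintegral_prod _ (hg' (by fun_prop) (by fun_prop)).aemeasurable]
        refine lintegral_congr fun s => ?_
        rw [lintegral_eq_lintegral_toSphere volume (hg' (by fun_prop) (by fun_prop))]
        simp only [norm_smul, finrank_euclideanSpace, Fintype.card_fin, norm_eq_of_mem_sphere,
          mul_one, lintegral_const, Real.norm_eq_abs, sq_abs, hH]
        rw [lintegral_indicator measurableSet_Ioi, mul_comm]
    _ = S * ∫⁻ p, H p := by
        rw [lintegral_const_mul _ hHm.lintegral_prod_right', Measure.volume_eq_prod,
          lintegral_prod _ hHm.aemeasurable]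
    _ = S * ∫⁻ p in Set.Ioi (0 : ℝ) ×ˢ Set.Ioo 0 Real.pi,
          ENNReal.ofReal (p.1 ^ d * Real.sin p.2 ^ (d - 1)) * g (p.1 * Real.cos p.2) p.1 := by
        congr 1
        rw [← lintegral_comp_polarCoord_symm, ← lintegral_indicator polarCoord.open_target.measurableSet,
          ← lintegral_indicator (measurableSet_Ioi.prod measurableSet_Ioo)]
        refine lintegral_congr fun p => ?_
        obtain ⟨r, θ⟩ := p
        simp only [Set.indicator, polarCoord_target, Set.mem_prod, Set.mem_Ioi, Set.mem_Ioo,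
          polarCoord_symm_apply, hH, smul_eq_mul]
        by_cases hr : 0 < r
        swap
        · simp [hr]
        by_cases h1 : 0 < θ ∧ θ < Real.pi
        · have hs := Real.sin_pos_of_pos_of_lt_pi h1.1 h1.2
          have h2 : -Real.pi < θ := by linarith [Real.pi_pos]
          have hsq : (r * Real.cos θ) ^ 2 + (r * Real.sin θ) ^ 2 = r ^ 2 := by
            linear_combination r ^ 2 * Real.cos_sq_add_sin_sq θ
          simp only [hr, h1, h2, and_self, if_true, mul_pos hr hs, hsq, Real.sqrt_sq hr.le]
          rw [← mul_assoc, ← ENNReal.ofReal_mul hr.le, mul_pow, ← mul_assoc, ← pow_succ',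
            Nat.sub_add_cancel hd]
        -- Angles in (-π, 0] give ρ = r sin θ ≤ 0, where the indicator in `H` vanishes.
        · have h5 : ¬(0 < r ∧ 0 < θ ∧ θ < Real.pi) := fun h => h1 h.2
          rw [if_neg h5]
          split_ifs with h2 h3
          · exfalso
            have h4 : θ ≤ 0 := by
              by_contra h; exact h1 ⟨not_le.1 h, h2.2.2⟩
            have := Real.sin_nonpos_of_nonpos_of_neg_pi_le h4 h2.2.1.le
            nlinarith
          · simp
          · rfl
    _ = _ := by
        rw [Measure.volume_eq_prod, ← Measure.prod_restrict, lintegral_prod]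
        exact (Measurable.mul (by fun_prop) (hg' (by fun_prop) (by fun_prop))).aemeasurable

-- Integrate f(z 0 / ‖z‖) over the unit ball in polar and in axial coordinates, after a rotation
-- taking x to the first axis. Both sides carry the same radial factor `R`, which is finite and
-- nonzero and cancels.
open scoped ENNReal in
theorem lintegral_toSphere_inner {d : ℕ} (hd : 1 ≤ d) {f : ℝ → ℝ≥0∞} (hf : Measurable f)
    (x : Metric.sphere (0 : EuclideanSpace ℝ (Fin (d + 1))) 1) :
    ∫⁻ y, f (inner ℝ (y : EuclideanSpace ℝ (Fin (d + 1))) (x : EuclideanSpace ℝ (Fin (d + 1))))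
        ∂(volume : Measure (EuclideanSpace ℝ (Fin (d + 1)))).toSphere =
      (volume : Measure (EuclideanSpace ℝ (Fin d))).toSphere Set.univ *
        ∫⁻ θ in Set.Ioo 0 Real.pi, ENNReal.ofReal (Real.sin θ ^ (d - 1)) * f (Real.cos θ) := by
  set e : ℝ → ℝ≥0∞ := (Set.Iio (1 : ℝ)).indicator 1 with he
  have hem : Measurable e := measurable_one.indicator measurableSet_Iio
  set R := ∫⁻ r in Set.Ioi (0 : ℝ), ENNReal.ofReal (r ^ d) * e r with hR
  have hR' : R = ∫⁻ r in Set.Ioo (0 : ℝ) 1, ENNReal.ofReal (r ^ d) := by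
    rw [hR, ← lintegral_indicator measurableSet_Ioi, ← lintegral_indicator measurableSet_Ioo]
    refine lintegral_congr fun r => ?_
    by_cases h0 : 0 < r <;> by_cases h1 : r < 1 <;> simp [he, Set.indicator, h0, h1]
  have hR0 : R ≠ 0 := by
    rw [hR', ← pos_iff_ne_zero, setLIntegral_pos_iff (by fun_prop)]
    refine lt_of_lt_of_le ?_ (measure_mono (s := Set.Ioo (0 : ℝ) 1) fun r hr => ⟨?_, hr⟩)
    · simp
    · simpa using pow_pos hr.1 d
  have hRtop : R ≠ ⊤ := by
    refine ne_top_of_le_ne_top (b := ∫⁻ r in Set.Ioo (0 : ℝ) 1, 1) (by simp) ?_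
    rw [hR']
    refine setLIntegral_mono (by fun_prop) fun r hr => ?_
    simpa using pow_le_one₀ hr.1.le hr.2.le
  obtain ⟨b, hb⟩ : ∃ b : OrthonormalBasis (Fin (d + 1)) ℝ (EuclideanSpace ℝ (Fin (d + 1))),
      b 0 = x := by
    obtain ⟨b, hb⟩ := Orthonormal.exists_orthonormalBasis_extension_of_card_eq
      (𝕜 := ℝ) (E := EuclideanSpace ℝ (Fin (d + 1))) (ι := Fin (d + 1)) (by simp)
      (v := fun _ => (x : EuclideanSpace ℝ (Fin (d + 1)))) (s := {0})
      ⟨fun i => by simp, fun i j h => (h (Subsingleton.elim i j)).elim⟩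
    exact ⟨b, hb 0 rfl⟩
  have key := lintegral_axial_eq hd (g := fun s r => f (s / r) * e r) (by
    exact (hf.comp (measurable_fst.div measurable_snd)).mul (hem.comp measurable_snd))
  rw [← (b.measurePreserving_repr).lintegral_comp (by fun_prop),
    lintegral_eq_lintegral_toSphere volume (by fun_prop)] at key
  have hleft : ∀ y : Metric.sphere (0 : EuclideanSpace ℝ (Fin (d + 1))) 1,
      (∫⁻ r in Set.Ioi (0 : ℝ), ENNReal.ofReal
        (r ^ (Module.finrank ℝ (EuclideanSpace ℝ (Fin (d + 1))) - 1)) *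
        (f ((b.repr (r • (y : EuclideanSpace ℝ (Fin (d + 1))))) 0 /
          ‖b.repr (r • (y : EuclideanSpace ℝ (Fin (d + 1))))‖) *
          e ‖b.repr (r • (y : EuclideanSpace ℝ (Fin (d + 1))))‖)) =
      f (inner ℝ (y : EuclideanSpace ℝ (Fin (d + 1))) (x : EuclideanSpace ℝ (Fin (d + 1)))) * R := by
    intro y
    rw [hR, ← lintegral_const_mul _ (by fun_prop)]
    refine setLIntegral_congr_fun measurableSet_Ioi fun r hr => ?_
    have hr : 0 < r := hr
    have h1 : ‖b.repr (r • (y : EuclideanSpace ℝ (Fin (d + 1))))‖ = r := by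
      rw [LinearIsometryEquiv.norm_map, norm_smul, norm_eq_of_mem_sphere, mul_one,
        Real.norm_of_nonneg hr.le]
    have h2 : (b.repr (r • (y : EuclideanSpace ℝ (Fin (d + 1))))) 0 / r =
        inner ℝ (y : EuclideanSpace ℝ (Fin (d + 1))) (x : EuclideanSpace ℝ (Fin (d + 1))) := by
      rw [b.repr_apply_apply, hb, real_inner_comm, real_inner_smul_left]
      field_simp
    simp only [h1, h2, finrank_euclideanSpace, Fintype.card_fin, Nat.add_sub_cancel]
    ring
  simp_rw [hleft] at key
  have hfm : Measurable fun y : Metric.sphere (0 : EuclideanSpace ℝ (Fin (d + 1))) 1 =>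
      f (inner ℝ (y : EuclideanSpace ℝ (Fin (d + 1))) (x : EuclideanSpace ℝ (Fin (d + 1)))) :=
    hf.comp (by fun_prop)
  rw [lintegral_mul_const _ hfm] at key
  rw [← ENNReal.mul_left_inj hR0 hRtop, key, mul_assoc]
  congr 1
  rw [hR, mul_comm, ← lintegral_mul_const _ (by fun_prop)]
  refine setLIntegral_congr_fun measurableSet_Ioi fun r hr => ?_
  have hr : 0 < r := hr
  rw [mul_comm, ← lintegral_mul_const _ (by fun_prop)]
  refine setLIntegral_congr_fun measurableSet_Ioo fun θ hθ => ?_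
  have h1 : r * Real.cos θ / r = Real.cos θ := by field_simp
  simp only [h1]
  rw [ENNReal.ofReal_mul (by positivity)]
  ring

/-! ### Zonal integrals against the normalized measure -/

namespace CapDiscrepancy

instance isProbabilityMeasure_sigma (d : ℕ) : IsProbabilityMeasure (sigma d) :=
  ⟨by
    rw [sigma, Measure.smul_apply, smul_eq_mul]
    exact ENNReal.inv_mul_cancel (Measure.measure_univ_ne_zero.2 (Measure.toSphere_ne_zero _))
      (measure_ne_top _ _)⟩

/-- The constant `Γ((d+1)/2) / (√π Γ(d/2))` normalizing the density `sin θ ^ (d - 1)` on `(0, π)`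
of the angle between a uniformly distributed point of `𝕊^d` and a fixed one. -/
noncomputable def sliceConst (d : ℕ) : ℝ :=
  Real.Gamma (((d : ℝ) + 1) / 2) / (Real.sqrt Real.pi * Real.Gamma ((d : ℝ) / 2))

theorem toSphere_univ_toReal {n : ℕ} (hn : 1 ≤ n) :
    ((volume : Measure (EuclideanSpace ℝ (Fin n))).toSphere Set.univ).toReal =
      2 * Real.sqrt Real.pi ^ n / Real.Gamma ((n : ℝ) / 2) := by
  have : Nonempty (Fin n) := ⟨⟨0, hn⟩⟩
  have hn' : (0 : ℝ) < n := by exact_mod_cast hn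
  have h1 : Real.Gamma ((n : ℝ) / 2 + 1) = (n : ℝ) / 2 * Real.Gamma ((n : ℝ) / 2) :=
    Real.Gamma_add_one (by positivity)
  have h2 : 0 < Real.Gamma ((n : ℝ) / 2) := Real.Gamma_pos_of_pos (by positivity)
  rw [Measure.toSphere_apply_univ, EuclideanSpace.volume_ball, ENNReal.toReal_mul]
  simp only [ENNReal.ofReal_one, one_pow, one_mul, Fintype.card_fin, finrank_euclideanSpace,
    ENNReal.toReal_natCast]
  rw [ENNReal.toReal_ofReal (by positivity), h1]
  field_simp

theorem sliceConst_pos {d : ℕ} (hd : 1 ≤ d) : 0 < sliceConst d := by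
  have hd' : (0 : ℝ) < d := by exact_mod_cast hd
  have h1 := Real.Gamma_pos_of_pos (s := (d : ℝ) / 2) (by positivity)
  have h2 := Real.Gamma_pos_of_pos (s := ((d : ℝ) + 1) / 2) (by positivity)
  unfold sliceConst
  positivity

/-- As an equality of measures, the slice formula passes to real integrals without any integrability
hypothesis. -/
theorem map_inner_toSphere {d : ℕ} (hd : 1 ≤ d) (x : Sph d) :
    Measure.map (fun y : Sph d => inner ℝ (y : EuclideanSpace ℝ (Fin (d + 1)))
        (x : EuclideanSpace ℝ (Fin (d + 1))))
      (volume : Measure (EuclideanSpace ℝ (Fin (d + 1)))).toSphere =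
    (volume : Measure (EuclideanSpace ℝ (Fin d))).toSphere Set.univ •
      Measure.map Real.cos ((volume.restrict (Set.Ioo 0 Real.pi)).withDensity
        fun θ => ENNReal.ofReal (Real.sin θ ^ (d - 1))) := by
  refine Measure.ext_of_lintegral _ fun f hf => ?_
  rw [lintegral_map hf (by fun_prop), lintegral_toSphere_inner hd hf, lintegral_smul_measure,
    lintegral_map hf (by fun_prop), lintegral_withDensity_eq_lintegral_mul _ (by fun_prop)
    (by fun_prop)]
  rfl

theorem integral_sigma_inner {d : ℕ} (hd : 1 ≤ d) {f : ℝ → ℝ} (hf : Measurable f) (x : Sph d) :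
    ∫ y : Sph d, f (inner ℝ (y : EuclideanSpace ℝ (Fin (d + 1)))
        (x : EuclideanSpace ℝ (Fin (d + 1)))) ∂(sigma d) =
      sliceConst d * ∫ θ in (0 : ℝ)..Real.pi, Real.sin θ ^ (d - 1) * f (Real.cos θ) := by
  have hd' : (0 : ℝ) < d := by exact_mod_cast hd
  have h1 := Real.Gamma_pos_of_pos (s := (d : ℝ) / 2) (by positivity)
  have h2 := Real.Gamma_pos_of_pos (s := ((d : ℝ) + 1) / 2) (by positivity)
  rw [sigma, integral_smul_measure, ← integral_map (f := f) (by fun_prop)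
    hf.aestronglyMeasurable, map_inner_toSphere hd, integral_smul_measure,
    integral_map (by fun_prop) hf.aestronglyMeasurable,
    integral_withDensity_eq_integral_toReal_smul (by fun_prop) (by simp), smul_smul,
    intervalIntegral.integral_of_le Real.pi_pos.le, integral_Ioc_eq_integral_Ioo, smul_eq_mul,
    ENNReal.toReal_inv, toSphere_univ_toReal hd, toSphere_univ_toReal (Nat.succ_pos d)]
  congr 1
  · rw [sliceConst, Nat.succ_eq_add_one, pow_succ]
    push_cast
    have := Real.sqrt_pos.2 Real.pi_pos
    field_simp
  · refine setIntegral_congr_fun measurableSet_Ioo fun θ hθ => ?_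
    have := (Real.sin_pos_of_pos_of_lt_pi hθ.1 hθ.2).le
    simp only [smul_eq_mul]
    rw [ENNReal.toReal_ofReal (by positivity)]

theorem integral_sigma_inner_id {d : ℕ} (hd : 2 ≤ d) (x : Sph d) :
    ∫ y : Sph d, inner ℝ (y : EuclideanSpace ℝ (Fin (d + 1)))
        (x : EuclideanSpace ℝ (Fin (d + 1))) ∂(sigma d) = 0 := by
  have hd' : (d : ℝ) ≠ 0 := by positivity
  -- Substituting u = sin θ sends both endpoints to 0.
  have h := intervalIntegral.integral_comp_mul_deriv (a := 0) (b := Real.pi) (f := Real.sin)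
    (f' := Real.cos) (g := fun u => u ^ (d - 1)) (fun θ _ => Real.hasDerivAt_sin θ)
    (by fun_prop) (by fun_prop)
  have h2 := integral_sigma_inner (by omega : 1 ≤ d) measurable_id x
  simp only [id, Function.comp_def, Real.sin_zero, Real.sin_pi, intervalIntegral.integral_same]
    at h h2
  rw [h2, h, mul_zero]

theorem integral_sin_pow_mul_abs_cos {d : ℕ} (hd : 1 ≤ d) :
    ∫ θ in (0 : ℝ)..Real.pi, Real.sin θ ^ (d - 1) * |Real.cos θ| = 2 / d := by
  have hd' : (d : ℝ) ≠ 0 := by positivity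
  have hp := Real.pi_pos
  have hder : ∀ θ, HasDerivAt (fun θ => Real.sin θ ^ d / d) (Real.sin θ ^ (d - 1) * Real.cos θ) θ := by
    intro θ
    convert! ((Real.hasDerivAt_sin θ).pow d).div_const (d : ℝ) using 1
    field_simp
  have hint : ∀ a b, ∫ θ in a..b, Real.sin θ ^ (d - 1) * Real.cos θ =
      Real.sin b ^ d / d - Real.sin a ^ d / d := fun a b =>
    intervalIntegral.integral_eq_sub_of_hasDerivAt (fun θ _ => hder θ)
      (Continuous.intervalIntegrable (by fun_prop) _ _)
  have hc : ∀ a b, IntervalIntegrable (fun θ => Real.sin θ ^ (d - 1) * |Real.cos θ|) volume a b :=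
    fun a b => Continuous.intervalIntegrable (by fun_prop) _ _
  rw [← intervalIntegral.integral_add_adjacent_intervals (hc 0 (Real.pi / 2)) (hc _ _)]
  have e1 : ∫ θ in (0 : ℝ)..(Real.pi / 2), Real.sin θ ^ (d - 1) * |Real.cos θ| = 1 / d := by
    rw [intervalIntegral.integral_congr (g := fun θ => Real.sin θ ^ (d - 1) * Real.cos θ), hint]
    · simp [zero_pow (by omega : d ≠ 0)]
    · intro θ hθ
      rw [Set.uIcc_of_le (by positivity)] at hθ
      simp only
      rw [abs_of_nonneg (Real.cos_nonneg_of_mem_Icc ⟨by linarith [hθ.1], hθ.2⟩)]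
  have e2 : ∫ θ in (Real.pi / 2)..Real.pi, Real.sin θ ^ (d - 1) * |Real.cos θ| = 1 / d := by
    rw [intervalIntegral.integral_congr (g := fun θ => -(Real.sin θ ^ (d - 1) * Real.cos θ)),
      intervalIntegral.integral_neg, hint]
    · simp [zero_pow (by omega : d ≠ 0)]
    · intro θ hθ
      rw [Set.uIcc_of_le (by linarith)] at hθ
      simp only
      rw [abs_of_nonpos (Real.cos_nonpos_of_pi_div_two_le_of_le hθ.1 (by linarith [hθ.2]))]
      ring
  rw [e1, e2]
  ring

theorem integral_sigma_abs_inner {d : ℕ} (hd : 1 ≤ d) (x : Sph d) :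
    ∫ y : Sph d, |inner ℝ (y : EuclideanSpace ℝ (Fin (d + 1)))
        (x : EuclideanSpace ℝ (Fin (d + 1)))| ∂(sigma d) = 2 * stolarskyConst d := by
  rw [integral_sigma_inner hd (f := fun u => |u|) (by fun_prop),
    integral_sin_pow_mul_abs_cos hd, sliceConst, stolarskyConst]
  ring

/-! ### Decay of spherical Gaussian averages -/

/-- The constant `Γ((d+1)/2) / (2√π)` in the decay `t ^ (-d/2)` of spherical Gaussian averages. -/
noncomputable def gaussConst (d : ℕ) : ℝ :=
  Real.Gamma (((d : ℝ) + 1) / 2) / (2 * Real.sqrt Real.pi)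

theorem gaussConst_pos (d : ℕ) : 0 < gaussConst d := by
  have h2 := Real.Gamma_pos_of_pos (s := ((d : ℝ) + 1) / 2) (by positivity)
  unfold gaussConst
  positivity

/-- With τ = 1 - cos θ, sin² θ = τ(2 - τ) ≤ 2τ, and d ≥ 2 makes the exponent d/2 - 1 nonnegative, so
the density may be replaced by (2τ)^(d/2 - 1). Extending the range from [0, 2] to the half-line
leaves a Gamma integral. -/
theorem integral_sigma_exp_le {d : ℕ} (hd : 2 ≤ d) {t : ℝ} (ht : 0 < t) (x : Sph d) :
    ∫ y : Sph d, Real.exp (-(2 * t * (1 - inner ℝ (y : EuclideanSpace ℝ (Fin (d + 1)))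
        (x : EuclideanSpace ℝ (Fin (d + 1)))))) ∂(sigma d) ≤
      gaussConst d * t ^ (-((d : ℝ) / 2)) := by
  have hd2 : (2 : ℝ) ≤ d := by exact_mod_cast hd
  have ha : 0 ≤ (d : ℝ) / 2 - 1 := by linarith
  set f : ℝ → ℝ := fun τ => Real.exp (-(2 * t * τ)) * (2 * τ) ^ ((d : ℝ) / 2 - 1) with hf
  have hfc : Continuous f := by
    have := Real.continuous_rpow_const ha
    exact (by fun_prop : Continuous fun τ => Real.exp (-(2 * t * τ))).mul
      (this.comp (continuous_const.mul continuous_id))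
  have hfI : ∀ τ ∈ Set.Ioi (0 : ℝ), f τ =
      2 ^ ((d : ℝ) / 2 - 1) * (τ ^ ((d : ℝ) / 2 - 1) * Real.exp (-(2 * t * τ))) := by
    intro τ hτ
    rw [hf]
    simp only
    rw [Real.mul_rpow zero_le_two (le_of_lt hτ)]
    ring
  have hval : ∫ τ in Set.Ioi (0 : ℝ), f τ =
      1 / 2 * t ^ (-((d : ℝ) / 2)) * Real.Gamma ((d : ℝ) / 2) := by
    rw [setIntegral_congr_fun measurableSet_Ioi hfI, integral_const_mul,
      Real.integral_rpow_mul_exp_neg_mul_Ioi (by positivity) (by positivity),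
      Real.rpow_sub two_pos, Real.rpow_one, Real.rpow_neg ht.le, one_div, Real.inv_rpow
      (by positivity), Real.mul_rpow two_pos.le ht.le]
    have := Real.rpow_pos_of_pos two_pos ((d : ℝ) / 2)
    have := Real.rpow_pos_of_pos ht ((d : ℝ) / 2)
    field_simp
  have hΓ := Real.Gamma_pos_of_pos (s := (d : ℝ) / 2) (by positivity)
  -- A non-integrable function has integral 0 by convention, contradicting the positive value
  -- `hval`.
  have hfint : IntegrableOn f (Set.Ioi 0) := by
    by_contra h
    rw [integral_undef h] at hval
    have := Real.rpow_pos_of_pos ht (-((d : ℝ) / 2))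
    have : 0 < 1 / 2 * t ^ (-((d : ℝ) / 2)) * Real.Gamma ((d : ℝ) / 2) := by positivity
    linarith
  have hle : ∫ θ in (0 : ℝ)..Real.pi,
      Real.sin θ ^ (d - 1) * Real.exp (-(2 * t * (1 - Real.cos θ))) ≤
      ∫ θ in (0 : ℝ)..Real.pi, (f ∘ fun θ => 1 - Real.cos θ) θ * Real.sin θ := by
    refine intervalIntegral.integral_mono_on Real.pi_pos.le
      (Continuous.intervalIntegrable (by fun_prop) _ _)
      (Continuous.intervalIntegrable (by fun_prop) _ _) fun θ hθ => ?_
    have hs := Real.sin_nonneg_of_mem_Icc hθ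
    have h1 : Real.sin θ ^ (d - 2) = (Real.sin θ ^ 2) ^ ((d : ℝ) / 2 - 1) := by
      rw [← Real.rpow_natCast, ← Real.rpow_natCast, ← Real.rpow_mul hs, Nat.cast_sub hd]
      congr 1
      push_cast
      ring
    have h2 : Real.sin θ ^ 2 ≤ 2 * (1 - Real.cos θ) := by
      rw [Real.sin_sq]
      nlinarith [sq_nonneg (1 - Real.cos θ)]
    have h3 := Real.rpow_le_rpow (sq_nonneg _) h2 ha
    have h4 : d - 1 = (d - 2) + 1 := by omega
    rw [h4, pow_succ, h1]
    simp only [Function.comp, hf]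
    calc _ = Real.exp (-(2 * t * (1 - Real.cos θ))) *
          (Real.sin θ ^ 2) ^ ((d : ℝ) / 2 - 1) * Real.sin θ := by ring
      _ ≤ _ := by gcongr
  have hsub : ∫ θ in (0 : ℝ)..Real.pi, (f ∘ fun θ => 1 - Real.cos θ) θ * Real.sin θ =
      ∫ τ in (0 : ℝ)..2, f τ := by
    have := intervalIntegral.integral_comp_mul_deriv (a := 0) (b := Real.pi)
      (f := fun θ => 1 - Real.cos θ) (f' := Real.sin) (g := f)
      (fun θ _ => by simpa using (Real.hasDerivAt_cos θ).const_sub 1) (by fun_prop) hfc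
    rw [this]
    norm_num
  have hmono : ∫ τ in (0 : ℝ)..2, f τ ≤ ∫ τ in Set.Ioi (0 : ℝ), f τ := by
    rw [intervalIntegral.integral_of_le zero_le_two]
    refine setIntegral_mono_set hfint ?_ (Eventually.of_forall fun _ h => h.1)
    filter_upwards [ae_restrict_mem measurableSet_Ioi] with τ hτ
    have : 0 < τ := hτ
    simp only [hf, Pi.zero_apply]
    positivity
  rw [integral_sigma_inner (by omega : 1 ≤ d) (f := fun u => Real.exp (-(2 * t * (1 - u))))
    (by fun_prop)]
  calc _ ≤ sliceConst d * (1 / 2 * t ^ (-((d : ℝ) / 2)) * Real.Gamma ((d : ℝ) / 2)) :=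
        mul_le_mul_of_nonneg_left ((hle.trans hsub.le).trans (hmono.trans hval.le))
          (sliceConst_pos (by omega)).le
    _ = _ := by
        rw [sliceConst, gaussConst]
        field_simp

end CapDiscrepancy

/-! ### Kernel energies as squared distances of features -/

/-- The squared `L²(m)` distance between the average of the features `Φ (x k)` and the mean feature,
when the kernel `∫ Φ z q Φ w q dm` has constant means. -/
theorem integral_sq_average_sub_mean {X Q : Type*} [MeasurableSpace X] [MeasurableSpace Q]
    (σ : Measure X) [IsProbabilityMeasure σ] (m : Measure Q) [SFinite m] {Φ : X → Q → ℝ}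
    (hΦ : Measurable (Function.uncurry Φ)) {G : Q → ℝ} (hG : Integrable (fun q => G q ^ 2) m)
    (hb : ∀ z q, |Φ z q| ≤ G q) {κ : ℝ} (hκ : ∀ z, ∫ w, ∫ q, Φ z q * Φ w q ∂m ∂σ = κ)
    {N : ℕ} (hN : 0 < N) (x : Fin N → X) :
    ∫ q, ((∑ k, Φ (x k) q) / N - ∫ z, Φ z q ∂σ) ^ 2 ∂m =
      (∑ j, ∑ k, ∫ q, Φ (x j) q * Φ (x k) q ∂m) / N ^ 2 - κ := by
  have hN' : (N : ℝ) ≠ 0 := by positivity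
  have hΦz : ∀ z, Measurable (Φ z) := fun z => hΦ.comp measurable_prodMk_left
  set φ : Q → ℝ := fun q => ∫ z, Φ z q ∂σ with hφ
  have hφm : Measurable φ := (hΦ.stronglyMeasurable.integral_prod_left').measurable
  have hφb : ∀ q, |φ q| ≤ G q := by
    intro q
    have := norm_integral_le_of_norm_le_const (μ := σ) (f := fun z => Φ z q) (C := G q)
      (Eventually.of_forall fun z => hb z q)
    simpa using this
  have hprod : ∀ {a b : Q → ℝ}, Measurable a → Measurable b → (∀ q, |a q| ≤ G q) →
      (∀ q, |b q| ≤ G q) → Integrable (fun q => a q * b q) m := by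
    intro a b ha hb' h1 h2
    refine hG.mono' (ha.mul hb').aestronglyMeasurable (Eventually.of_forall fun q => ?_)
    rw [Real.norm_eq_abs, abs_mul, sq]
    exact mul_le_mul (h1 q) (h2 q) (abs_nonneg _) ((abs_nonneg _).trans (h1 q))
  have hswap : ∀ {a : Q → ℝ}, Measurable a → (∀ q, |a q| ≤ G q) →
      ∫ q, a q * φ q ∂m = ∫ w, ∫ q, a q * Φ w q ∂m ∂σ := by
    intro a ha h1
    rw [integral_integral_swap]
    · exact integral_congr_ae (Eventually.of_forall fun q => (integral_const_mul _ _).symm)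
    · refine (hG.comp_snd σ).mono' ((ha.comp measurable_snd).mul hΦ).aestronglyMeasurable
        (Eventually.of_forall fun p => ?_)
      simp only [Function.uncurry, Real.norm_eq_abs, abs_mul, sq]
      exact mul_le_mul (h1 _) (hb _ _) (abs_nonneg _) ((abs_nonneg _).trans (h1 _))
  -- Each feature has inner product κ with the mean feature, whose squared norm is then κ too. The
  -- expanded square thus contributes -2κ + κ.
  have h1 : ∀ z, ∫ q, Φ z q * φ q ∂m = κ := fun z => by rw [hswap (hΦz z) (hb z), hκ]
  have h2 : ∫ q, φ q * φ q ∂m = κ := by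
    rw [hswap hφm hφb]
    simp_rw [mul_comm (φ _), h1]
    simp
  have hexp : ∀ q, ((∑ k, Φ (x k) q) / N - φ q) ^ 2 =
      (∑ j, ∑ k, Φ (x j) q * Φ (x k) q) / N ^ 2 - 2 / N * (∑ k, Φ (x k) q * φ q) + φ q * φ q := by
    intro q
    rw [← Finset.sum_mul_sum, ← Finset.sum_mul]
    field_simp
    ring
  refine (integral_congr_ae (Eventually.of_forall hexp)).trans ?_
  have i1 : ∀ j k, Integrable (fun q => Φ (x j) q * Φ (x k) q) m := fun j k =>
    hprod (hΦz _) (hΦz _) (hb _) (hb _)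
  have i2 : ∀ k, Integrable (fun q => Φ (x k) q * φ q) m := fun k =>
    hprod (hΦz _) hφm (hb _) hφb
  have i1' : Integrable (fun q => (∑ j, ∑ k, Φ (x j) q * Φ (x k) q) / (N : ℝ) ^ 2) m :=
    (integrable_finsetSum _ fun j _ => integrable_finsetSum _ fun k _ => i1 j k).div_const _
  have i2' : Integrable (fun q => 2 / (N : ℝ) * (∑ k, Φ (x k) q * φ q)) m :=
    (integrable_finsetSum _ fun k _ => i2 k).const_mul _
  have i3 : Integrable (fun q => (∑ j, ∑ k, Φ (x j) q * Φ (x k) q) / (N : ℝ) ^ 2 -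
      2 / (N : ℝ) * (∑ k, Φ (x k) q * φ q)) m := i1'.sub i2'
  rw [integral_add i3 (hprod hφm hφm hφb hφb), integral_sub i1' i2', h2,
    integral_div, integral_const_mul, integral_finsetSum _ fun k _ => i2 k,
    integral_finsetSum _ fun j _ => integrable_finsetSum _ fun k _ => i1 j k]
  simp_rw [h1, integral_finsetSum _ fun k _ => i1 _ k]
  simp only [Finset.sum_const, Finset.card_univ, Fintype.card_fin, nsmul_eq_mul]
  field_simp
  ring

/-! ### Positivity of the Gaussian energy gap -/

namespace CapDiscrepancy

theorem norm_sub_sq_sph {d : ℕ} (z w : Sph d) :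
    ‖(z : EuclideanSpace ℝ (Fin (d + 1))) - w‖ ^ 2 =
      2 * (1 - inner ℝ (z : EuclideanSpace ℝ (Fin (d + 1)))
        (w : EuclideanSpace ℝ (Fin (d + 1)))) := by
  rw [norm_sub_sq_real, norm_eq_of_mem_sphere, norm_eq_of_mem_sphere]
  ring

/-- Zonal kernels have constant means. -/
theorem exists_integral_sigma_norm_sub {d : ℕ} (hd : 1 ≤ d) {f : ℝ → ℝ} (hf : Measurable f) :
    ∃ κ, ∀ z : Sph d, ∫ w : Sph d, f ‖(z : EuclideanSpace ℝ (Fin (d + 1))) - w‖ ∂(sigma d) = κ := by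
  refine ⟨sliceConst d * ∫ θ in (0 : ℝ)..Real.pi, Real.sin θ ^ (d - 1) *
    f (Real.sqrt (2 * (1 - Real.cos θ))), fun z => ?_⟩
  rw [← integral_sigma_inner hd (f := fun u => f (Real.sqrt (2 * (1 - u)))) (by fun_prop) z]
  refine integral_congr_ae (Eventually.of_forall fun w => ?_)
  simp only
  rw [real_inner_comm, ← norm_sub_sq_sph, Real.sqrt_sq (norm_nonneg _)]

/-- The potential `∫ exp (-t ‖z - w‖²) dσ(w)`, evaluated at an arbitrary point of the sphere. -/
noncomputable def gaussMean (d : ℕ) (t : ℝ) : ℝ :=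
  ∫ w : Sph d, Real.exp (-t * ‖EuclideanSpace.single 0 1 - (w : EuclideanSpace ℝ (Fin (d + 1)))‖ ^ 2)
    ∂(sigma d)

theorem integral_exp_neg_norm_sub {d : ℕ} (hd : 1 ≤ d) (t : ℝ) (z : Sph d) :
    ∫ w : Sph d, Real.exp (-t * ‖(z : EuclideanSpace ℝ (Fin (d + 1))) - w‖ ^ 2) ∂(sigma d) =
      gaussMean d t := by
  obtain ⟨κ, hκ⟩ := exists_integral_sigma_norm_sub hd (f := fun r => Real.exp (-t * r ^ 2))
    (by fun_prop)
  rw [hκ z, ← hκ ⟨EuclideanSpace.single 0 1, by simp⟩, gaussMean]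

theorem gaussMean_le {d : ℕ} (hd : 2 ≤ d) {t : ℝ} (ht : 0 < t) :
    gaussMean d t ≤ gaussConst d * t ^ (-((d : ℝ) / 2)) := by
  let z : Sph d := ⟨EuclideanSpace.single 0 1, by simp⟩
  refine le_trans (le_of_eq ?_) (integral_sigma_exp_le hd ht z)
  rw [← integral_exp_neg_norm_sub (by omega) t z]
  refine integral_congr_ae (Eventually.of_forall fun w => ?_)
  simp only
  rw [norm_sub_sq_sph, real_inner_comm]
  ring_nf

/-- Up to the factor `C`, the Gaussian kernel is the L² inner product of Gaussians of rate 2t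
centred at z and w, so the difference is a squared norm divided by `C`. -/
theorem gaussMean_le_average {d N : ℕ} (hd : 1 ≤ d) (hN : 0 < N) (x : Fin N → Sph d) {t : ℝ}
    (ht : 0 < t) :
    gaussMean d t ≤
      (∑ j, ∑ k, Real.exp (-t * ‖(x j : EuclideanSpace ℝ (Fin (d + 1))) - x k‖ ^ 2)) / N ^ 2 := by
  set E := EuclideanSpace ℝ (Fin (d + 1))
  set C : ℝ := ∫ q : E, Real.exp (-(4 * t) * ‖q‖ ^ 2) with hC
  have hCpos : 0 < C := by
    rw [hC, GaussianFourier.integral_rexp_neg_mul_sq_norm (by positivity)]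
    positivity
  set Φ : Sph d → E → ℝ := fun z q => Real.exp (-(2 * t) * ‖(z : E) - q‖ ^ 2) with hΦ
  have hker : ∀ z w, ∫ q, Φ z q * Φ w q = C * Real.exp (-t * ‖(z : E) - w‖ ^ 2) := by
    intro z w
    have : ∀ q, Φ z q * Φ w q = Real.exp (-(4 * t) * ‖q - (1 / 2 : ℝ) • ((z : E) + w)‖ ^ 2) *
        Real.exp (-t * ‖(z : E) - w‖ ^ 2) := by
      intro q
      simp only [hΦ]
      rw [← Real.exp_add, ← Real.exp_add]
      -- The parallelogram law separates the distance from q to the midpoint of z and w from the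
      -- distance between z and w.
      congr 1
      have h1 := parallelogram_law_with_norm ℝ ((z : E) - q) ((w : E) - q)
      have h2 : (z : E) - q + ((w : E) - q) = -((2 : ℝ) • (q - (1 / 2 : ℝ) • ((z : E) + w))) := by
        module
      have h3 : (z : E) - q - ((w : E) - q) = z - w := by abel
      rw [h2, h3, norm_neg, norm_smul, Real.norm_of_nonneg zero_le_two] at h1
      linear_combination t * h1
    simp_rw [this, integral_mul_const]
    rw [integral_sub_right_eq_self (fun q : E => Real.exp (-(4 * t) * ‖q‖ ^ 2))]
  have hb : ∀ z q, |Φ z q| ≤ Real.exp (2 * t) * Real.exp (-t * ‖q‖ ^ 2) := by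
    intro z q
    rw [hΦ, abs_of_pos (Real.exp_pos _), ← Real.exp_add]
    refine Real.exp_le_exp.2 ?_
    have h1 : ‖q‖ ≤ ‖(z : E) - q‖ + 1 := by
      have := norm_sub_le (z : E) ((z : E) - q)
      rw [sub_sub_cancel, norm_eq_of_mem_sphere] at this
      linarith
    have h2 : ‖q‖ ^ 2 ≤ 2 * ‖(z : E) - q‖ ^ 2 + 2 := by
      nlinarith [norm_nonneg q, norm_nonneg ((z : E) - q), sq_nonneg (‖(z : E) - q‖ - 1)]
    nlinarith
  have hG : Integrable (fun q : E => (Real.exp (2 * t) * Real.exp (-t * ‖q‖ ^ 2)) ^ 2) := by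
    have h1 : Integrable (fun q : E => Real.exp (-(2 * t) * ‖q‖ ^ 2)) := by
      by_contra h
      have := GaussianFourier.integral_rexp_neg_mul_sq_norm (V := E) (b := 2 * t) (by positivity)
      rw [integral_undef h] at this
      have h2 : 0 < (Real.pi / (2 * t)) ^ ((Module.finrank ℝ E : ℝ) / 2) := by positivity
      linarith
    refine (h1.const_mul (Real.exp (2 * t) ^ 2)).congr (Eventually.of_forall fun q => ?_)
    simp only
    rw [mul_pow, ← Real.exp_nat_mul (-t * ‖q‖ ^ 2)]
    push_cast
    ring_nf
  have hmeas : Measurable (Function.uncurry Φ) := by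
    simp only [hΦ, Function.uncurry_def]
    fun_prop
  have key := integral_sq_average_sub_mean (sigma d) (volume : Measure E) hmeas hG hb
    (κ := C * gaussMean d t) (fun z => by
      simp_rw [hker, integral_const_mul]
      rw [integral_exp_neg_norm_sub hd]) hN x
  simp_rw [hker, ← Finset.mul_sum] at key
  have hnonneg : 0 ≤ ∫ q, ((∑ k, Φ (x k) q) / N - ∫ z, Φ z q ∂(sigma d)) ^ 2 :=
    integral_nonneg fun q => sq_nonneg _
  rw [key, mul_div_assoc, ← mul_sub] at hnonneg
  linarith [nonneg_of_mul_nonneg_right hnonneg hCpos]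

/-! ### Stolarsky's invariance principle -/

theorem abs_inner_sph_le {d : ℕ} (z p : Sph d) :
    |inner ℝ (z : EuclideanSpace ℝ (Fin (d + 1))) (p : EuclideanSpace ℝ (Fin (d + 1)))| ≤ 1 := by
  simpa using abs_real_inner_le_norm (z : EuclideanSpace ℝ (Fin (d + 1))) p

theorem integrable_sigma_of_continuous {d : ℕ} {f : Sph d → ℝ} (hf : Continuous f) :
    Integrable f (sigma d) :=
  hf.integrable_of_hasCompactSupport (HasCompactSupport.of_compactSpace f)

/-- For z ≠ w, normalizing z - w gives a point of the sphere, and the first absolute moment does not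
depend on the point. -/
theorem integral_sigma_abs_inner_sub {d : ℕ} (hd : 1 ≤ d) (z w : Sph d) :
    ∫ p : Sph d, |inner ℝ (z : EuclideanSpace ℝ (Fin (d + 1))) (p : EuclideanSpace ℝ (Fin (d + 1))) -
        inner ℝ (w : EuclideanSpace ℝ (Fin (d + 1))) (p : EuclideanSpace ℝ (Fin (d + 1)))|
        ∂(sigma d) =
      2 * stolarskyConst d * ‖(z : EuclideanSpace ℝ (Fin (d + 1))) - w‖ := by
  by_cases hzw : (z : EuclideanSpace ℝ (Fin (d + 1))) - w = 0
  · simp [← inner_sub_left, hzw]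
  have hn : 0 < ‖(z : EuclideanSpace ℝ (Fin (d + 1))) - w‖ := norm_pos_iff.2 hzw
  let v : Sph d := ⟨‖(z : EuclideanSpace ℝ (Fin (d + 1))) - w‖⁻¹ •
    ((z : EuclideanSpace ℝ (Fin (d + 1))) - w), by simp [norm_smul, hn.ne']⟩
  rw [← integral_sigma_abs_inner hd v, ← integral_mul_const]
  refine integral_congr_ae (Eventually.of_forall fun p => ?_)
  simp only [v]
  rw [← inner_sub_left, real_inner_smul_right, abs_mul, abs_of_pos (inv_pos.2 hn), real_inner_comm]
  field_simp

/-- The indicator `1_{C(p, t)}(z)` as a function of `z` and `(t, p)`. -/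
noncomputable def capFeature {d : ℕ} (z : Sph d) (q : ℝ × Sph d) : ℝ :=
  if q.1 ≤ inner ℝ (z : EuclideanSpace ℝ (Fin (d + 1))) (q.2 : EuclideanSpace ℝ (Fin (d + 1)))
  then 1 else 0

theorem measurable_capFeature (d : ℕ) :
    Measurable (Function.uncurry (capFeature : Sph d → ℝ × Sph d → ℝ)) := by
  refine Measurable.ite (measurableSet_le ?_ ?_) measurable_const measurable_const <;> fun_prop

theorem abs_capFeature_le {d : ℕ} (z : Sph d) (q : ℝ × Sph d) : |capFeature z q| ≤ 1 := by
  unfold capFeature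
  split_ifs <;> simp

/-- For fixed p, the integral over t is 1 + min(a, b) with a = z · p and b = w · p. Since min(a, b)
= (a + b - |a - b|)/2 and the linear terms have mean zero, only the distance term survives. -/
theorem integral_capFeature_mul {d : ℕ} (hd : 2 ≤ d) (z w : Sph d) :
    ∫ q, capFeature z q * capFeature w q
        ∂((volume.restrict (Set.Ioc (-1 : ℝ) 1)).prod (sigma d)) =
      1 - stolarskyConst d * ‖(z : EuclideanSpace ℝ (Fin (d + 1))) - w‖ := by
  have hm : ∀ z, Measurable (capFeature z : ℝ × Sph d → ℝ) := fun z =>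
    (measurable_capFeature d).comp measurable_prodMk_left
  have hint : Integrable (fun q => capFeature z q * capFeature w q)
      ((volume.restrict (Set.Ioc (-1 : ℝ) 1)).prod (sigma d)) := by
    refine (integrable_const (1 : ℝ)).mono' ((hm z).mul (hm w)).aestronglyMeasurable
      (Eventually.of_forall fun q => ?_)
    rw [Real.norm_eq_abs, abs_mul]
    exact mul_le_one₀ (abs_capFeature_le z q) (abs_nonneg _) (abs_capFeature_le w q)
  have hinner : ∀ p : Sph d, ∫ t in Set.Ioc (-1 : ℝ) 1, capFeature z (t, p) * capFeature w (t, p) =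
      1 + 1 / 2 * (inner ℝ (z : EuclideanSpace ℝ (Fin (d + 1))) (p : EuclideanSpace ℝ (Fin (d + 1))) +
        inner ℝ (w : EuclideanSpace ℝ (Fin (d + 1))) (p : EuclideanSpace ℝ (Fin (d + 1))) -
        |inner ℝ (z : EuclideanSpace ℝ (Fin (d + 1))) (p : EuclideanSpace ℝ (Fin (d + 1))) -
        inner ℝ (w : EuclideanSpace ℝ (Fin (d + 1))) (p : EuclideanSpace ℝ (Fin (d + 1)))|) := by
    intro p
    have ha := abs_le.1 (abs_inner_sph_le z p)
    have hb := abs_le.1 (abs_inner_sph_le w p)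
    simp only [capFeature]
    set a := inner ℝ (z : EuclideanSpace ℝ (Fin (d + 1))) (p : EuclideanSpace ℝ (Fin (d + 1)))
    set b := inner ℝ (w : EuclideanSpace ℝ (Fin (d + 1))) (p : EuclideanSpace ℝ (Fin (d + 1)))
    have h1 : ∀ t : ℝ, ((if t ≤ a then (1 : ℝ) else 0) * if t ≤ b then 1 else 0) =
        (Set.Iic (min a b)).indicator 1 t := by
      intro t
      by_cases h1 : t ≤ a <;> by_cases h2 : t ≤ b <;> simp [Set.indicator, h1, h2]
    have h2 : Set.Iic (min a b) ∩ Set.Ioc (-1) 1 = Set.Ioc (-1) (min a b) := by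
      ext t
      simp only [Set.mem_inter_iff, Set.mem_Iic, Set.mem_Ioc, le_min_iff]
      constructor
      · tauto
      · rintro ⟨h, h', h''⟩
        exact ⟨⟨h', h''⟩, h, h'.trans ha.2⟩
    refine (integral_congr_ae (Eventually.of_forall h1)).trans ?_
    rw [integral_indicator_one measurableSet_Iic, measureReal_restrict_apply measurableSet_Iic, h2,
      Real.volume_real_Ioc_of_le (le_min ha.1 hb.1), ← sub_eq_zero]
    rcases le_total a b with h | h
    · rw [min_eq_left h, abs_of_nonpos (by linarith)]
      ring
    · rw [min_eq_right h, abs_of_nonneg (by linarith)]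
      ring
  have hzero : ∀ z : Sph d, ∫ p : Sph d, inner ℝ (z : EuclideanSpace ℝ (Fin (d + 1)))
      (p : EuclideanSpace ℝ (Fin (d + 1))) ∂(sigma d) = 0 := by
    intro z
    rw [← integral_sigma_inner_id hd z]
    exact integral_congr_ae (Eventually.of_forall fun p => real_inner_comm _ _)
  rw [integral_prod_symm _ hint]
  simp_rw [hinner]
  rw [integral_add (by fun_prop), integral_const_mul, integral_sub, integral_add, hzero, hzero,
    integral_sigma_abs_inner_sub (by omega)]
  · simp
    ring
  all_goals exact integrable_sigma_of_continuous (by fun_prop)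

/-- The mean distance `∫ ‖z - w‖ dσ(w)`, evaluated at an arbitrary point of the sphere. -/
noncomputable def meanDist (d : ℕ) : ℝ :=
  ∫ w : Sph d, ‖EuclideanSpace.single 0 1 - (w : EuclideanSpace ℝ (Fin (d + 1)))‖ ∂(sigma d)

theorem integral_norm_sub {d : ℕ} (hd : 1 ≤ d) (z : Sph d) :
    ∫ w : Sph d, ‖(z : EuclideanSpace ℝ (Fin (d + 1))) - w‖ ∂(sigma d) = meanDist d := by
  obtain ⟨κ, hκ⟩ := exists_integral_sigma_norm_sub hd measurable_id
  simp only [id] at hκ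
  rw [hκ z, ← hκ ⟨EuclideanSpace.single 0 1, by simp⟩, meanDist]

/-- Stolarsky's invariance principle. -/
theorem discrepancy_sq {d N : ℕ} (hd : 2 ≤ d) (hN : 0 < N) (x : Fin N → Sph d) :
    discrepancy x ^ 2 = stolarskyConst d * (meanDist d -
      (∑ j, ∑ k, ‖(x j : EuclideanSpace ℝ (Fin (d + 1))) - x k‖) / N ^ 2) := by
  have hN' : (N : ℝ) ≠ 0 := by positivity
  set m := (volume.restrict (Set.Ioc (-1 : ℝ) 1)).prod (sigma d) with hm
  have hf : ∀ z, Measurable (capFeature z : ℝ × Sph d → ℝ) := fun z =>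
    (measurable_capFeature d).comp measurable_prodMk_left
  -- The additive 1 of the cap kernel also appears in κ and cancels.
  have key := integral_sq_average_sub_mean (sigma d) m (measurable_capFeature d) (G := fun _ => 1)
    (by simp) abs_capFeature_le
    (κ := 1 - stolarskyConst d * meanDist d) (fun z => by
      simp_rw [hm, integral_capFeature_mul hd]
      rw [integral_sub (integrable_const _) (integrable_sigma_of_continuous (by fun_prop)),
        integral_const_mul, integral_norm_sub (by omega)]
      simp) hN x
  have hcap : ∀ (t : ℝ) (p : Sph d), (sigma d).real (cap p t) =
      ∫ z, capFeature z (t, p) ∂(sigma d) := by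
    intro t p
    have hms : MeasurableSet (cap p t) := measurableSet_le measurable_const (by fun_prop)
    rw [← integral_indicator_one hms]
    rfl
  have hcount : ∀ (t : ℝ) (p : Sph d), ({k : Fin N | x k ∈ cap p t}.ncard : ℝ) =
      ∑ k, capFeature (x k) (t, p) := by
    intro t p
    classical
    simp only [capFeature]
    rw [Finset.sum_boole, ← Set.ncard_coe_finset]
    congr 2
    ext k
    simp [cap]
  have hmean : Measurable fun q : ℝ × Sph d => ∫ z, capFeature z q ∂(sigma d) :=
    ((measurable_capFeature d).stronglyMeasurable.integral_prod_left').measurable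
  have hint : Integrable (fun q : ℝ × Sph d => ((∑ k, capFeature (x k) q) / N -
      ∫ z, capFeature z q ∂(sigma d)) ^ 2) m := by
    refine (integrable_const ((2 : ℝ) ^ 2)).mono' (by fun_prop) (Eventually.of_forall fun q => ?_)
    rw [Real.norm_eq_abs, abs_pow]
    have h1 : |(∑ k, capFeature (x k) q) / N| ≤ 1 := by
      rw [abs_div, Nat.abs_cast, div_le_one (by positivity)]
      refine (Finset.abs_sum_le_sum_abs _ _).trans ?_
      refine (Finset.sum_le_sum fun k _ => abs_capFeature_le (x k) q).trans ?_
      simp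
    have h2 : |∫ z, capFeature z q ∂(sigma d)| ≤ 1 := by
      have := norm_integral_le_of_norm_le_const (μ := sigma d) (f := fun z => capFeature z q)
        (C := 1) (Eventually.of_forall fun z => abs_capFeature_le z q)
      simpa using this
    exact pow_le_pow_left₀ (abs_nonneg _) ((abs_sub _ _).trans (by linarith)) 2
  have heq : (∫ t in (-1 : ℝ)..1, ∫ p : Sph d,
      |(({k : Fin N | x k ∈ cap p t}.ncard : ℝ) / (N : ℝ)) - (sigma d).real (cap p t)| ^ 2
        ∂(sigma d)) = ∫ q, ((∑ k, capFeature (x k) q) / N -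
      ∫ z, capFeature z q ∂(sigma d)) ^ 2 ∂m := by
    rw [hm, integral_prod _ hint, intervalIntegral.integral_of_le (by norm_num)]
    simp_rw [sq_abs, hcap, hcount]
  rw [discrepancy, heq, Real.sq_sqrt (integral_nonneg fun q => sq_nonneg _), key]
  simp_rw [hm, integral_capFeature_mul hd, Finset.sum_sub_distrib, ← Finset.mul_sum]
  simp only [Finset.sum_const, Finset.card_univ, Fintype.card_fin, nsmul_eq_mul]
  field_simp
  ring

end CapDiscrepancy

/-! ### Distances as mixtures of Gaussians -/

theorem integrableOn_one_sub_exp_mul_rpow {b : ℝ} (hb : 0 ≤ b) :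
    IntegrableOn (fun t : ℝ => (1 - Real.exp (-t * b)) * t ^ (-3 / 2 : ℝ)) (Set.Ioi 0) := by
  have hmeas : Measurable fun t : ℝ => (1 - Real.exp (-t * b)) * t ^ (-3 / 2 : ℝ) := by fun_prop
  rw [← Set.Ioc_union_Ioi_eq_Ioi zero_le_one]
  refine IntegrableOn.union ?_ ?_
  · have h : IntegrableOn (fun t : ℝ => b * t ^ (-1 / 2 : ℝ)) (Set.Ioc 0 1) :=
      ((intervalIntegrable_iff_integrableOn_Ioc_of_le zero_le_one).1
        (intervalIntegral.intervalIntegrable_rpow' (by norm_num))).const_mul b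
    refine h.mono' hmeas.aestronglyMeasurable ?_
    filter_upwards [ae_restrict_mem measurableSet_Ioc] with t ht
    have ht0 : 0 < t := ht.1
    have h1 : 0 ≤ 1 - Real.exp (-t * b) := by
      have : Real.exp (-t * b) ≤ 1 := Real.exp_le_one_iff.2 (by nlinarith)
      linarith
    have h2 : 1 - Real.exp (-t * b) ≤ t * b := by linarith [Real.add_one_le_exp (-t * b)]
    have h3 : t ^ (-1 / 2 : ℝ) = t * t ^ (-3 / 2 : ℝ) := by
      conv_rhs => rw [← Real.rpow_one_add' ht0.le (by norm_num)]
      norm_num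
    rw [Real.norm_of_nonneg (by positivity), h3, ← mul_assoc, mul_comm b]
    gcongr
  · have h : IntegrableOn (fun t : ℝ => t ^ (-3 / 2 : ℝ)) (Set.Ioi 1) :=
      integrableOn_Ioi_rpow_of_lt (by norm_num) one_pos
    refine h.mono' hmeas.aestronglyMeasurable ?_
    filter_upwards [ae_restrict_mem measurableSet_Ioi] with t ht
    have ht0 : 0 < t := one_pos.trans ht
    have h1 : 0 ≤ 1 - Real.exp (-t * b) := by
      have : Real.exp (-t * b) ≤ 1 := Real.exp_le_one_iff.2 (by nlinarith)
      linarith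
    rw [Real.norm_of_nonneg (by positivity)]
    refine mul_le_of_le_one_left (by positivity) ?_
    linarith [Real.exp_pos (-t * b)]

/-- Integration by parts reduces this to Γ(1/2). The boundary function `F` is O(√t) near 0 and
O(1/√t) at infinity, so both boundary terms vanish. -/
theorem integral_one_sub_exp_mul_rpow {b : ℝ} (hb : 0 ≤ b) :
    ∫ t in Set.Ioi (0 : ℝ), (1 - Real.exp (-t * b)) * t ^ (-3 / 2 : ℝ) =
      2 * Real.sqrt Real.pi * Real.sqrt b := by
  rcases hb.eq_or_lt with rfl | hb
  · simp
  have hΓ : ∫ t in Set.Ioi (0 : ℝ), t ^ (-1 / 2 : ℝ) * Real.exp (-(b * t)) =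
      Real.sqrt Real.pi / Real.sqrt b := by
    have := Real.integral_rpow_mul_exp_neg_mul_Ioi (a := 1 / 2) (by norm_num) hb
    rw [Real.Gamma_one_half_eq, ← Real.sqrt_eq_rpow, Real.sqrt_div zero_le_one, Real.sqrt_one]
      at this
    norm_num at this ⊢
    rw [this]
    ring
  have hpos : 0 < Real.sqrt Real.pi / Real.sqrt b := by positivity
  have hΓi : IntegrableOn (fun t : ℝ => t ^ (-1 / 2 : ℝ) * Real.exp (-(b * t))) (Set.Ioi 0) := by
    by_contra h
    rw [integral_undef h] at hΓ
    linarith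
  have hI := integrableOn_one_sub_exp_mul_rpow hb.le
  set F : ℝ → ℝ := fun t => -2 * (t ^ (-1 / 2 : ℝ) * (1 - Real.exp (-t * b))) with hF
  have hder : ∀ t ∈ Set.Ioi (0 : ℝ), HasDerivAt F
      ((1 - Real.exp (-t * b)) * t ^ (-3 / 2 : ℝ) -
        2 * b * (t ^ (-1 / 2 : ℝ) * Real.exp (-(b * t)))) t := by
    intro t ht
    have ht0 : t ≠ 0 := ne_of_gt ht
    have h1 := Real.hasDerivAt_rpow_const (x := t) (p := -1 / 2) (Or.inl ht0)
    have h2 : HasDerivAt (fun t => 1 - Real.exp (-t * b)) (-(Real.exp (-t * b) * (-1 * b))) t :=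
      (((hasDerivAt_id t).neg.mul_const b).exp).const_sub 1
    convert! (h1.mul h2).const_mul (-2) using 1
    norm_num
    ring_nf
  have hFn : ∀ t, 0 < t → ‖F t‖ = 2 * (t ^ (-1 / 2 : ℝ) * (1 - Real.exp (-t * b))) := by
    intro t ht
    have h0 : Real.exp (-t * b) ≤ 1 := Real.exp_le_one_iff.2 (by nlinarith)
    have h1 : 0 ≤ 1 - Real.exp (-t * b) := by linarith
    simp only [hF]
    rw [Real.norm_eq_abs, abs_mul, abs_neg, abs_two,
      abs_of_nonneg (mul_nonneg (by positivity) h1)]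
  have hupper : ∀ t, 0 < t → ‖F t‖ ≤ 2 * t ^ (-(1 / 2) : ℝ) := by
    intro t ht
    have h2 : 1 - Real.exp (-t * b) ≤ 1 := by linarith [Real.exp_pos (-t * b)]
    rw [hFn t ht, ← neg_div]
    exact mul_le_mul_of_nonneg_left (mul_le_of_le_one_right (by positivity) h2) zero_le_two
  have hlower : ∀ t, 0 < t → ‖F t‖ ≤ 2 * b * t ^ (1 / 2 : ℝ) := by
    intro t ht
    have h2 : 1 - Real.exp (-t * b) ≤ t * b := by linarith [Real.add_one_le_exp (-t * b)]
    have h3 : t ^ (1 / 2 : ℝ) = t * t ^ (-1 / 2 : ℝ) := by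
      conv_rhs => rw [← Real.rpow_one_add' ht.le (by norm_num)]
      norm_num
    have h4 : 0 < t ^ (-1 / 2 : ℝ) := by positivity
    rw [hFn t ht, h3]
    nlinarith [mul_le_mul_of_nonneg_left h2 h4.le]
  have hF0 : F 0 = 0 := by simp [F]
  have hcont : ContinuousWithinAt F (Set.Ici 0) 0 := by
    rw [ContinuousWithinAt, hF0]
    have hlim : Tendsto (fun t : ℝ => 2 * b * t ^ (1 / 2 : ℝ)) (nhdsWithin 0 (Set.Ici 0))
        (nhds 0) := by
      have : ContinuousAt (fun t : ℝ => 2 * b * t ^ (1 / 2 : ℝ)) 0 :=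
        continuousAt_const.mul (Real.continuousAt_rpow_const _ _ (Or.inr (by norm_num)))
      have h := this.tendsto
      rw [Real.zero_rpow (by norm_num), mul_zero] at h
      exact h.mono_left nhdsWithin_le_nhds
    refine squeeze_zero_norm' ?_ hlim
    filter_upwards [self_mem_nhdsWithin] with t ht
    rcases (show (0 : ℝ) ≤ t from ht).eq_or_lt with rfl | h
    · rw [hF0, norm_zero]; positivity
    · exact hlower t h
  have htop : Tendsto F atTop (nhds 0) := by
    have hlim : Tendsto (fun t : ℝ => 2 * t ^ (-(1 / 2) : ℝ)) atTop (nhds 0) := by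
      simpa using (tendsto_rpow_neg_atTop (y := 1 / 2) (by norm_num)).const_mul 2
    refine squeeze_zero_norm' ?_ hlim
    filter_upwards [eventually_gt_atTop 0] with t ht using hupper t ht
  have h := integral_Ioi_of_hasDerivAt_of_tendsto hcont hder (hI.sub (hΓi.const_mul (2 * b))) htop
  rw [integral_sub hI (hΓi.const_mul (2 * b)), integral_const_mul, hΓ, hF0, sub_zero,
    sub_eq_zero] at h
  rw [h]
  have := Real.sqrt_pos.2 hb
  field_simp
  rw [Real.sq_sqrt hb.le]

namespace CapDiscrepancy

/-- This is Fubini for the mixture formula. The integrand is nonnegative for t > 0 and its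
t-integral is continuous in w, which gives integrability on the product. -/
theorem meanDist_eq (d : ℕ) :
    IntegrableOn (fun t : ℝ => (1 - gaussMean d t) * t ^ (-3 / 2 : ℝ)) (Set.Ioi 0) ∧
    ∫ t in Set.Ioi (0 : ℝ), (1 - gaussMean d t) * t ^ (-3 / 2 : ℝ) =
      2 * Real.sqrt Real.pi * meanDist d := by
  set e : EuclideanSpace ℝ (Fin (d + 1)) := EuclideanSpace.single 0 1 with he
  set h : Sph d → ℝ → ℝ := fun w t =>
    (1 - Real.exp (-t * ‖e - (w : EuclideanSpace ℝ (Fin (d + 1)))‖ ^ 2)) * t ^ (-3 / 2 : ℝ) with hh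
  have hval : ∀ w, ∫ t in Set.Ioi (0 : ℝ), h w t =
      2 * Real.sqrt Real.pi * ‖e - (w : EuclideanSpace ℝ (Fin (d + 1)))‖ := by
    intro w
    rw [hh, integral_one_sub_exp_mul_rpow (sq_nonneg _), Real.sqrt_sq (norm_nonneg _)]
  have hnorm : ∀ w, ∀ t ∈ Set.Ioi (0 : ℝ), ‖h w t‖ = h w t := by
    intro w t ht
    have ht : 0 < t := ht
    have h0 : Real.exp (-t * ‖e - (w : EuclideanSpace ℝ (Fin (d + 1)))‖ ^ 2) ≤ 1 :=
      Real.exp_le_one_iff.2 (by nlinarith [sq_nonneg ‖e - (w : EuclideanSpace ℝ (Fin (d + 1)))‖])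
    exact Real.norm_of_nonneg (mul_nonneg (by linarith) (by positivity))
  have hint : Integrable (Function.uncurry h) ((sigma d).prod (volume.restrict (Set.Ioi 0))) := by
    have hm : Measurable (Function.uncurry h) := by
      simp only [hh, Function.uncurry_def]
      fun_prop
    rw [integrable_prod_iff hm.aestronglyMeasurable]
    have hI : ∀ w, IntegrableOn (h w) (Set.Ioi 0) := fun w =>
      integrableOn_one_sub_exp_mul_rpow (sq_nonneg ‖e - (w : EuclideanSpace ℝ (Fin (d + 1)))‖)
    refine ⟨Eventually.of_forall hI, ?_⟩
    refine (integrable_sigma_of_continuous (f := fun w : Sph d => 2 * Real.sqrt Real.pi *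
      ‖e - (w : EuclideanSpace ℝ (Fin (d + 1)))‖) (by fun_prop)).congr
      (Eventually.of_forall fun w => ?_)
    simp only
    rw [← hval w]
    exact setIntegral_congr_fun measurableSet_Ioi fun t ht => (hnorm w t ht).symm
  have hmean : ∀ t, ∫ w, h w t ∂(sigma d) = (1 - gaussMean d t) * t ^ (-3 / 2 : ℝ) := by
    intro t
    rw [hh]
    simp only
    rw [integral_mul_const, integral_sub (integrable_const _)
      (integrable_sigma_of_continuous (by fun_prop))]
    simp [gaussMean, he]
  refine ⟨?_, ?_⟩
  · exact hint.integral_prod_right.congr (Eventually.of_forall hmean)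
  · simp_rw [← hmean]
    rw [← integral_integral_swap hint]
    simp_rw [hval]
    rw [integral_const_mul]
    rfl

/-! ### Lower bound for the distance gap -/

theorem diagonal_le_sum_exp {d N : ℕ} (x : Fin N → Sph d) (t : ℝ) :
    (N : ℝ) ≤ ∑ j, ∑ k, Real.exp (-t * ‖(x j : EuclideanSpace ℝ (Fin (d + 1))) - x k‖ ^ 2) := by
  calc (N : ℝ) = ∑ j : Fin N, (1 : ℝ) := by simp
    _ ≤ _ := Finset.sum_le_sum fun j _ => by
        refine le_trans (by simp) (Finset.single_le_sum (f := fun k =>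
          Real.exp (-t * ‖(x j : EuclideanSpace ℝ (Fin (d + 1))) - x k‖ ^ 2))
          (fun k _ => (Real.exp_pos _).le) (Finset.mem_univ j))

/-- The cutoff is the zero of 1/N - A t^(-d/2), with A = `gaussConst d`. The expression is positive
exactly beyond it, so this choice maximizes the integral. -/
theorem integral_Ioi_lower {N d : ℕ} (hN : 0 < N) (hd : 1 ≤ d) :
    IntegrableOn (fun t : ℝ => (1 / N - gaussConst d * t ^ (-((d : ℝ) / 2))) * t ^ (-3 / 2 : ℝ))
      (Set.Ioi ((gaussConst d * N) ^ (2 / (d : ℝ)))) ∧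
    ∫ t in Set.Ioi ((gaussConst d * N) ^ (2 / (d : ℝ))),
        (1 / N - gaussConst d * t ^ (-((d : ℝ) / 2))) * t ^ (-3 / 2 : ℝ) =
      2 * (1 / (1 + 1 / (d : ℝ))) * (gaussConst d * N) ^ (-(1 / (d : ℝ))) / N := by
  have hA := gaussConst_pos d
  have hN' : (0 : ℝ) < N := by exact_mod_cast hN
  have hd' : (0 : ℝ) < d := by exact_mod_cast hd
  set B := gaussConst d * N with hB
  have hBpos : 0 < B := by positivity
  set T := B ^ (2 / (d : ℝ)) with hT
  have hTpos : 0 < T := by positivity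
  have hE : Set.EqOn (fun t : ℝ => 1 / N * t ^ (-3 / 2 : ℝ) -
      gaussConst d * t ^ (-((d : ℝ) / 2) + -3 / 2))
      (fun t : ℝ => (1 / N - gaussConst d * t ^ (-((d : ℝ) / 2))) * t ^ (-3 / 2 : ℝ))
      (Set.Ioi T) := by
    intro t ht
    simp only
    rw [Real.rpow_add (hTpos.trans ht)]
    ring
  have i1 : IntegrableOn (fun t : ℝ => 1 / (N : ℝ) * t ^ (-3 / 2 : ℝ)) (Set.Ioi T) :=
    (integrableOn_Ioi_rpow_of_lt (by norm_num) hTpos).const_mul _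
  have hlt : -((d : ℝ) / 2) + -3 / 2 < -1 := by linarith
  have i2 : IntegrableOn (fun t : ℝ => gaussConst d * t ^ (-((d : ℝ) / 2) + -3 / 2)) (Set.Ioi T) :=
    (integrableOn_Ioi_rpow_of_lt hlt hTpos).const_mul _
  refine ⟨(i1.sub i2).congr_fun hE measurableSet_Ioi, ?_⟩
  rw [← setIntegral_congr_fun measurableSet_Ioi hE, integral_sub i1 i2, integral_const_mul,
    integral_const_mul, integral_Ioi_rpow_of_lt (by norm_num) hTpos,
    integral_Ioi_rpow_of_lt hlt hTpos]
  have e1 : T ^ (-3 / 2 + 1 : ℝ) = B ^ (-(1 / (d : ℝ))) := by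
    rw [hT, ← Real.rpow_mul hBpos.le]
    congr 1
    ring
  have e2 : T ^ (-((d : ℝ) / 2) + -3 / 2 + 1) = B ^ (-(1 / (d : ℝ))) / B := by
    rw [hT, ← Real.rpow_mul hBpos.le, ← Real.rpow_sub_one hBpos.ne']
    congr 1
    field_simp
    ring
  rw [e1, e2, hB]
  have h1 : -((d : ℝ) / 2) + -3 / 2 + 1 ≠ 0 := by linarith
  have h2 : (1 : ℝ) + 1 / d ≠ 0 := by positivity
  have h3 : -((d : ℝ) / 2) + -3 / 2 + 1 = -((d + 1) / 2) := by ring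
  rw [h3]
  field_simp
  ring

theorem le_meanDist_sub_average {d N : ℕ} (hd : 2 ≤ d) (hN : 0 < N) (x : Fin N → Sph d) :
    1 / (1 + 1 / (d : ℝ)) * (gaussConst d * N) ^ (-(1 / (d : ℝ))) / (Real.sqrt Real.pi * N) ≤
      meanDist d - (∑ j, ∑ k, ‖(x j : EuclideanSpace ℝ (Fin (d + 1))) - x k‖) / N ^ 2 := by
  have hN' : (0 : ℝ) < N := by exact_mod_cast hN
  have hA := gaussConst_pos d
  have hπ : 0 < Real.sqrt Real.pi := Real.sqrt_pos.2 Real.pi_pos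
  obtain ⟨hVi, hV⟩ := meanDist_eq d
  set r : Fin N → Fin N → ℝ := fun j k => ‖(x j : EuclideanSpace ℝ (Fin (d + 1))) - x k‖ with hr
  -- The weighted Gaussian gap at scale t; its integral is 2√π times the distance gap.
  set P : ℝ → ℝ := fun t =>
    ((∑ j, ∑ k, Real.exp (-t * r j k ^ 2)) / N ^ 2 - gaussMean d t) * t ^ (-3 / 2 : ℝ) with hP
  have hPeq : ∀ t, P t = (1 - gaussMean d t) * t ^ (-3 / 2 : ℝ) -
      (∑ j, ∑ k, (1 - Real.exp (-t * r j k ^ 2)) * t ^ (-3 / 2 : ℝ)) / N ^ 2 := by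
    intro t
    simp_rw [← Finset.sum_mul, Finset.sum_sub_distrib]
    simp only [hP, Finset.sum_const, Finset.card_univ, Fintype.card_fin, nsmul_eq_mul]
    field_simp
    ring
  have hi : ∀ j k, IntegrableOn (fun t : ℝ =>
      (1 - Real.exp (-t * r j k ^ 2)) * t ^ (-3 / 2 : ℝ)) (Set.Ioi 0) := fun j k =>
    integrableOn_one_sub_exp_mul_rpow (sq_nonneg _)
  have hS : IntegrableOn (fun t : ℝ =>
      (∑ j, ∑ k, (1 - Real.exp (-t * r j k ^ 2)) * t ^ (-3 / 2 : ℝ)) / (N : ℝ) ^ 2) (Set.Ioi 0) :=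
    (integrable_finsetSum _ fun j _ => integrable_finsetSum _ fun k _ => hi j k).div_const _
  have hPi : IntegrableOn P (Set.Ioi 0) :=
    (hVi.sub hS).congr (Eventually.of_forall fun t => (hPeq t).symm)
  have hPval : ∫ t in Set.Ioi (0 : ℝ), P t =
      2 * Real.sqrt Real.pi * (meanDist d - (∑ j, ∑ k, r j k) / N ^ 2) := by
    simp_rw [hPeq]
    rw [integral_sub hVi hS, hV, integral_div, integral_finsetSum _ fun j _ =>
      integrable_finsetSum _ fun k _ => hi j k]
    simp_rw [integral_finsetSum _ fun k _ => hi _ k, integral_one_sub_exp_mul_rpow (sq_nonneg _)]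
    have : ∀ j k, Real.sqrt (r j k ^ 2) = r j k := fun j k => Real.sqrt_sq (norm_nonneg _)
    simp_rw [this, ← Finset.mul_sum]
    ring
  have hP0 : ∀ t ∈ Set.Ioi (0 : ℝ), 0 ≤ P t := by
    intro t ht
    have ht : 0 < t := ht
    have := gaussMean_le_average (by omega) hN x ht
    exact mul_nonneg (sub_nonneg.2 this) (by positivity)
  set T := (gaussConst d * N) ^ (2 / (d : ℝ)) with hT
  have hTpos : 0 < T := by positivity
  obtain ⟨hLi, hL⟩ := integral_Ioi_lower (d := d) hN (by omega)
  have h1 : ∫ t in Set.Ioi T, P t ≤ ∫ t in Set.Ioi (0 : ℝ), P t := by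
    refine setIntegral_mono_set hPi ?_ (Set.Ioi_subset_Ioi hTpos.le).eventuallyLE
    filter_upwards [ae_restrict_mem measurableSet_Ioi] with t ht using hP0 t ht
  have h2 := setIntegral_mono_on hLi (hPi.mono_set (Set.Ioi_subset_Ioi hTpos.le))
    measurableSet_Ioi fun t (ht : T < t) => by
      have ht0 : 0 < t := hTpos.trans ht
      refine mul_le_mul_of_nonneg_right (sub_le_sub ?_ (gaussMean_le hd ht0)) (by positivity)
      rw [le_div_iff₀ (by positivity)]
      refine le_trans (le_of_eq ?_) (diagonal_le_sum_exp x t)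
      field_simp
  have h3 := h2.trans h1
  rw [hL, hPval] at h3
  rw [div_le_iff₀ (by positivity)]
  rw [div_le_iff₀ hN'] at h3
  linarith

/-! ### Assembling the constant -/

theorem stolarskyConst_nonneg (d : ℕ) : 0 ≤ stolarskyConst d := by
  have h1 := Real.Gamma_nonneg_of_nonneg (s := (d : ℝ) / 2) (by positivity)
  have h2 := Real.Gamma_nonneg_of_nonneg (s := ((d : ℝ) + 1) / 2) (by positivity)
  unfold stolarskyConst
  positivity

theorem discrepancy_nonneg {d N : ℕ} (x : Fin N → Sph d) : 0 ≤ discrepancy x :=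
  Real.sqrt_nonneg _

/-- The bound holds for every configuration, not only asymptotically. -/
theorem cStar_le {d N : ℕ} (hd : 2 ≤ d) (hN : 0 < N) (x : Fin N → Sph d) :
    cStar d ≤ (N : ℝ) ^ ((1 : ℝ) / 2 + 1 / (2 * (d : ℝ))) * discrepancy x := by
  have hN' : (0 : ℝ) < N := by exact_mod_cast hN
  have hd' : (0 : ℝ) < d := by positivity
  have hA := gaussConst_pos d
  have hπ : 0 < Real.sqrt Real.pi := Real.sqrt_pos.2 Real.pi_pos
  refine Real.sqrt_le_iff.2 ⟨mul_nonneg (by positivity) (discrepancy_nonneg x), ?_⟩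
  rw [mul_pow, discrepancy_sq hd hN]
  have hpow : ((N : ℝ) ^ ((1 : ℝ) / 2 + 1 / (2 * (d : ℝ)))) ^ 2 = N * (N : ℝ) ^ (1 / (d : ℝ)) := by
    rw [← Real.rpow_natCast, ← Real.rpow_mul hN'.le, ← Real.rpow_one_add' hN'.le (by positivity)]
    congr 1
    field_simp
    push_cast
    ring
  -- The Gamma quotient in `cStar` is the reciprocal of the Gaussian decay constant, so its 1/d
  -- power comes from the cutoff.
  have hA' : 2 * Real.Gamma (1 / 2) / Real.Gamma (((d : ℝ) + 1) / 2) = (gaussConst d)⁻¹ := by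
    rw [gaussConst, inv_div, Real.Gamma_one_half_eq]
  rw [hpow, hA']
  refine le_trans (le_of_eq ?_) (mul_le_mul_of_nonneg_left (mul_le_mul_of_nonneg_left
    (le_meanDist_sub_average hd hN x) (stolarskyConst_nonneg d)) (by positivity))
  rw [Real.mul_rpow hA.le hN'.le, Real.rpow_neg hN'.le, Real.inv_rpow hA.le,
    Real.rpow_neg hA.le]
  have := Real.rpow_pos_of_pos hN' (1 / (d : ℝ))
  field_simp

theorem cStar_two : cStar 2 = 1 / Real.sqrt (3 * Real.sqrt Real.pi) := by
  have hπ : 0 < Real.sqrt Real.pi := Real.sqrt_pos.2 Real.pi_pos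
  have hΓ : Real.Gamma ((2 + 1) / 2) = Real.sqrt Real.pi / 2 := by
    rw [show ((2 : ℝ) + 1) / 2 = 1 / 2 + 1 by norm_num, Real.Gamma_add_one (by norm_num),
      Real.Gamma_one_half_eq]
    ring
  rw [cStar, stolarskyConst, one_div (Real.sqrt (3 * _)), ← Real.sqrt_inv]
  congr 1
  push_cast
  rw [hΓ, Real.Gamma_one_half_eq, ← Real.sqrt_eq_rpow, div_self two_ne_zero, Real.Gamma_one,
    show 2 * Real.sqrt Real.pi / (Real.sqrt Real.pi / 2) = 2 ^ 2 by field_simp,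
    Real.sqrt_sq zero_le_two]
  field_simp
  norm_num

end CapDiscrepancy

/-- The lower limit over `N → ∞` and all `x_1, …, x_N ∈ 𝕊^d` is the `liminf` in `N` of the infimum
over all configurations of `N` points, taken in the extended reals. -/
theorem mainTheorem6 :
    (∀ d : ℕ, 2 ≤ d →
      ((CapDiscrepancy.cStar d : ℝ) : EReal) ≤
        liminf (fun N : ℕ => ⨅ x : Fin N → CapDiscrepancy.Sph d,
          (((N : ℝ) ^ ((1 : ℝ) / 2 + 1 / (2 * (d : ℝ))) *
            CapDiscrepancy.discrepancy x : ℝ) : EReal)) atTop) ∧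
    CapDiscrepancy.cStar 2 = 1 / Real.sqrt (3 * Real.sqrt Real.pi) := by
  refine ⟨fun d hd => le_liminf_of_le (by isBoundedDefault) ?_, CapDiscrepancy.cStar_two⟩
  filter_upwards [eventually_gt_atTop 0] with N hN
  exact le_iInf fun x => EReal.coe_le_coe_iff.2 (CapDiscrepancy.cStar_le hd hN x)
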